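/- Let $n\ge 2$ and $l\ge 1$ be integers, and let $\Omega\subset\mathbb R^n$ be a bounded domain (a nonempty connected bounded open set) of volume $|\Omega|$. Let $\lambda_1\le\lambda_2\le\cdots$ be the eigenvalues, each repeated according to its multiplicity, of the Dirichlet problem for the polyharmonic operator $$(-\Delta)^l u=\lambda u \ \text{ in } \Omega,\qquad u=\frac{\partial u}{\partial\nu}=\cdots=\frac{\partial^{l-1}u}{\partial\nu^{l-1}}=0\ \text{ on }\partial\Omega,$$ understood in the weak sense: $u$ belongs to $H^l_0(\Omega)$, the closure of $C_c^\infty(\Omega)$ in the Sobolev space $H^l(\Omega)$, and $\int_\Omega u\,(-\Delta)^l\varphi\,dx=\lambda\int_\Omega u\,\varphi\,dx$ for all $\varphi\in C_c^\infty(\Omega)$. Then all $\lambda_j$ are positive and, for every real $p$ with $0<p<\frac{n}{2l}$ and every $k\in\mathbb N$, $$\sum_{j=1}^k\lambda_j^{-p}\ \le\ (4\pi)^{-lp}\,\frac{n}{n-2lp}\left(\frac{|\Omega|}{\Gamma\left(1+\frac n2\right)}\right)^{\frac{2lp}{n}}k^{\,1-\frac{2lp}{n}}.$$ -/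

import Mathlib

open scoped Distributions LineDeriv
open MeasureTheory TopologicalSpace

noncomputable section

namespace Polyharmonic

variable {n : ℕ}

/-- The real Hilbert space `L²(Ω)`. -/
abbrev L2 (Ω : Opens (EuclideanSpace ℝ (Fin n))) : Type :=
  Lp ℝ 2 (volume.restrict (Ω : Set (EuclideanSpace ℝ (Fin n))))

/-- The inclusion of the test functions `C_c^∞(Ω)` in `L²(Ω)`. -/
def toL2 (Ω : Opens (EuclideanSpace ℝ (Fin n))) : 𝓓(Ω, ℝ) →ₗ[ℝ] L2 Ω where
  toFun φ := (φ.continuous.memLp_of_hasCompactSupport φ.hasCompactSupport).toLp φ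
  map_add' _ _ := rfl
  map_smul' _ _ := rfl

/-- The partial derivative `∂_{s 0} ⋯ ∂_{s (i-1)} φ`, of order `i`, of a test function. -/
def partialDeriv {Ω : Opens (EuclideanSpace ℝ (Fin n))} {i : ℕ} (s : Fin i → Fin n)
    (φ : 𝓓(Ω, ℝ)) : 𝓓(Ω, ℝ) :=
  ∂^{fun j => EuclideanSpace.single (s j) (1 : ℝ)} φ

/-- `g` is the weak derivative `∂_s u` on `Ω`:
`∫_Ω u ∂_s φ = (-1)^i ∫_Ω g φ` for all test functions `φ`. -/
def HasWeakDeriv {Ω : Opens (EuclideanSpace ℝ (Fin n))} {i : ℕ} (s : Fin i → Fin n)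
    (u g : L2 Ω) : Prop :=
  ∀ φ : 𝓓(Ω, ℝ),
    inner ℝ u (toL2 Ω (partialDeriv s φ)) = (-1 : ℝ) ^ i * inner ℝ g (toL2 Ω φ)

/-- `u ∈ H_0^l(Ω)`: the function `u` has weak derivatives `g i s` in `L²(Ω)` for all orders
`i ≤ l`, and it is the limit in `H^l(Ω)` of a sequence of test functions. -/
def MemSobolevZero (Ω : Opens (EuclideanSpace ℝ (Fin n))) (l : ℕ) (u : L2 Ω) : Prop :=
  ∃ g : (i : ℕ) → (Fin i → Fin n) → L2 Ω,
    (∀ i ≤ l, ∀ s : Fin i → Fin n, HasWeakDeriv s u (g i s)) ∧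
    ∃ φ : ℕ → 𝓓(Ω, ℝ), ∀ i ≤ l, ∀ s : Fin i → Fin n,
      Filter.Tendsto (fun m => toL2 Ω (partialDeriv s (φ m))) Filter.atTop (nhds (g i s))

/-- The polyharmonic operator `(-Δ)^l` on test functions. -/
def polyLaplacian (Ω : Opens (EuclideanSpace ℝ (Fin n))) (l : ℕ) : 𝓓(Ω, ℝ) → 𝓓(Ω, ℝ) :=
  (fun φ => -LineDeriv.laplacianCLM ℝ (EuclideanSpace ℝ (Fin n)) 𝓓(Ω, ℝ) φ)^[l]

/-- The space of weak solutions of the Dirichlet problem for `(-Δ)^l u = μ u` on `Ω`: all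
`u ∈ H_0^l(Ω)` (this encodes `u = ∂u/∂ν = ⋯ = ∂^{l-1}u/∂ν^{l-1} = 0` on the boundary) such that
`∫_Ω u (-Δ)^l φ = μ ∫_Ω u φ` for all test functions `φ`. -/
def eigenspace (Ω : Opens (EuclideanSpace ℝ (Fin n))) (l : ℕ) (μ : ℝ) :
    Submodule ℝ (L2 Ω) where
  carrier := {u | MemSobolevZero Ω l u ∧ ∀ φ : 𝓓(Ω, ℝ),
    inner ℝ u (toL2 Ω (polyLaplacian Ω l φ)) = μ * inner ℝ u (toL2 Ω φ)}
  zero_mem' := by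
    refine ⟨⟨fun _ _ => 0, fun i _ s φ => by simp, fun _ => 0, fun i _ s => ?_⟩,
      fun φ => by simp⟩
    simp [partialDeriv, LineDeriv.iteratedLineDerivOp_zero]
  add_mem' := by
    rintro u v ⟨⟨g, hg, φ, hφ⟩, hu⟩ ⟨⟨h, hh, ψ, hψ⟩, hv⟩
    refine ⟨⟨fun i s => g i s + h i s, fun i hi s χ => ?_, fun m => φ m + ψ m,
      fun i hi s => ?_⟩, fun χ => ?_⟩
    · rw [inner_add_left, inner_add_left, hg i hi s χ, hh i hi s χ, mul_add]
    · simpa [partialDeriv, LineDeriv.iteratedLineDerivOp_add] using (hφ i hi s).add (hψ i hi s)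
    · rw [inner_add_left, inner_add_left, hu χ, hv χ, mul_add]
  smul_mem' := by
    rintro c u ⟨⟨g, hg, φ, hφ⟩, hu⟩
    refine ⟨⟨fun i s => c • g i s, fun i hi s χ => ?_, fun m => c • φ m,
      fun i hi s => ?_⟩, fun χ => ?_⟩
    · rw [real_inner_smul_left, real_inner_smul_left, hg i hi s χ, mul_left_comm]
    · simpa [partialDeriv, LineDeriv.iteratedLineDerivOp_smul] using (hφ i hi s).const_smul c
    · rw [real_inner_smul_left, real_inner_smul_left, hu χ, mul_left_comm]

/-- `ev 0 ≤ ev 1 ≤ ⋯` is the list of all eigenvalues of the Dirichlet problem for `(-Δ)^l` on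
`Ω`, each one repeated according to its multiplicity, that is, the dimension of its eigenspace
(a real number that is not an eigenvalue has multiplicity `0` and does not occur). -/
structure IsEigenvalueList (Ω : Opens (EuclideanSpace ℝ (Fin n))) (l : ℕ) (ev : ℕ → ℝ) :
    Prop where
  monotone : Monotone ev
  multiplicity : ∀ μ : ℝ,
    {j : ℕ | ev j = μ}.encard = Cardinal.toENat (Module.rank ℝ (eigenspace Ω l μ))

end Polyharmonic

end

/-! For orthonormal eigenfunctions u_j, put F_j = |û_j|². By Plancherel F_j is a probability
density, and the weak equation makes λ_j its moment ∫ (2π|ξ|)^{2l} F_j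
(`integral_symbol_mul_norm_hat_sq`). As t ↦ t^{-p} is convex, Jensen's inequality
(`rpow_neg_le_integral`) gives λ_j^{-p} ≤ ∫ (2π|ξ|)^{-2lp} F_j.

Bessel's inequality for the plane waves on Ω bounds ∑ F_j pointwise by |Ω| (`sum_norm_hat_sq_le`),
while its total mass is k. The weight decreases in |ξ|, so the integral is largest when the mass
fills a centred ball at height |Ω| (`integral_norm_rpow_neg_mul_le`); it is finite because 2lp < n.
The radius with |Ω||B_R| = k yields the constant. -/

noncomputable section

namespace Polyharmonic

open scoped FourierTransform SchwartzMap ContDiff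
open Real

variable {n : ℕ} {Ω : Opens (EuclideanSpace ℝ (Fin n))}

/-! ### Test functions and their Fourier transforms -/

/-- A real test function, extended by zero and regarded as a complex Schwartz function. -/
def toSchwartz (φ : 𝓓(Ω, ℝ)) : 𝓢(EuclideanSpace ℝ (Fin n), ℂ) :=
  (show HasCompactSupport (fun x => (φ x : ℂ)) from
    φ.hasCompactSupport.comp_left Complex.ofReal_zero).toSchwartzMap
    (Complex.ofRealCLM.contDiff.comp φ.contDiff)

@[simp]
theorem toSchwartz_apply (φ : 𝓓(Ω, ℝ)) (x : EuclideanSpace ℝ (Fin n)) :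
    toSchwartz φ x = (φ x : ℂ) := rfl

theorem toSchwartz_sub (φ ψ : 𝓓(Ω, ℝ)) :
    toSchwartz (φ - ψ) = toSchwartz φ - toSchwartz ψ := by
  ext x; simp

theorem lineDerivOp_apply (v : EuclideanSpace ℝ (Fin n)) (φ : 𝓓(Ω, ℝ))
    (x : EuclideanSpace ℝ (Fin n)) : (∂_{v} φ) x = fderiv ℝ φ x v := by
  rw [TestFunction.lineDerivOp_eq_lineDerivCLM (𝕜 := ℝ),
    TestFunction.lineDerivCLM_apply_of_le (by simp),
    (φ.contDiff.differentiable (by simp)).differentiableAt.lineDeriv_eq_fderiv]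

theorem toSchwartz_lineDerivOp (v : EuclideanSpace ℝ (Fin n)) (φ : 𝓓(Ω, ℝ)) :
    toSchwartz (∂_{v} φ) = ∂_{v} (toSchwartz φ) := by
  ext x
  rw [SchwartzMap.lineDerivOp_apply_eq_fderiv, toSchwartz_apply, lineDerivOp_apply]
  have h := Complex.ofRealCLM.hasFDerivAt.comp x
    (φ.contDiff.differentiable (by simp)).differentiableAt.hasFDerivAt
  have h2 : fderiv ℝ (toSchwartz φ) x = _ := h.fderiv
  rw [h2]
  rfl

theorem lineDerivOp_comm (v w : EuclideanSpace ℝ (Fin n)) (φ : 𝓓(Ω, ℝ)) :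
    ∂_{v} (∂_{w} φ) = ∂_{w} (∂_{v} φ) := by
  have key (v w x) : (∂_{v} (∂_{w} φ)) x = fderiv ℝ (fderiv ℝ φ) x v w := by
    rw [lineDerivOp_apply]
    have : ((∂_{w} φ : 𝓓(Ω, ℝ)) : EuclideanSpace ℝ (Fin n) → ℝ) = fun y => fderiv ℝ φ y w :=
      funext (lineDerivOp_apply w φ)
    have hd : DifferentiableAt ℝ (fderiv ℝ φ) x :=
      ((φ.contDiff.fderiv_right (m := 1) (by norm_cast)).differentiable (by simp)).differentiableAt
    rw [this, fderiv_clm_apply hd (by fun_prop)]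
    simp
  ext x
  rw [key, key]
  exact (φ.contDiff.contDiffAt.isSymmSndFDerivAt (by simp; norm_cast)).eq v w

theorem norm_toSchwartz_toLp (φ : 𝓓(Ω, ℝ)) :
    ‖(toSchwartz φ).toLp 2 volume‖ = ‖toL2 Ω φ‖ := by
  have h1 : ‖toL2 Ω φ‖ = (eLpNorm φ 2 (volume.restrict Ω)).toReal :=
    Lp.norm_toLp _ (φ.continuous.memLp_of_hasCompactSupport φ.hasCompactSupport)
  rw [h1, eLpNorm_restrict_eq_of_support_subset
    ((subset_tsupport _).trans φ.tsupport_subset)]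
  rw [SchwartzMap.norm_toLp]
  congr 1
  exact eLpNorm_congr_norm_ae (.of_forall fun x => by simp)

theorem fourier_toSchwartz_lineDerivOp (v : EuclideanSpace ℝ (Fin n)) (φ : 𝓓(Ω, ℝ))
    (ξ : EuclideanSpace ℝ (Fin n)) :
    𝓕 (toSchwartz (∂_{v} φ)) ξ =
      (2 * π * Complex.I) * (inner ℝ ξ v : ℝ) * 𝓕 (toSchwartz φ) ξ := by
  have : (inner ℝ · v).HasTemperateGrowth := ((innerSL ℝ).flip v).hasTemperateGrowth
  rw [toSchwartz_lineDerivOp, SchwartzMap.fourier_lineDerivOp_eq, _root_.smul_apply,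
    SchwartzMap.smulLeftCLM_apply_apply this]
  simp [mul_assoc]

theorem fourier_toSchwartz_partialDeriv {i : ℕ} (s : Fin i → Fin n) (φ : 𝓓(Ω, ℝ))
    (ξ : EuclideanSpace ℝ (Fin n)) :
    𝓕 (toSchwartz (partialDeriv s φ)) ξ =
      (∏ j, (2 * π * Complex.I) * (ξ (s j) : ℂ)) * 𝓕 (toSchwartz φ) ξ := by
  induction i with
  | zero => simp [partialDeriv]
  | succ i ih =>
    have h : partialDeriv s φ =
      ∂_{EuclideanSpace.single (s 0) (1 : ℝ)} (partialDeriv (Fin.tail s) φ) := rfl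
    rw [h, fourier_toSchwartz_lineDerivOp, ih, Fin.prod_univ_succ]
    have : inner ℝ ξ (EuclideanSpace.single (s 0) (1 : ℝ)) = ξ (s 0) := by
      simp [EuclideanSpace.inner_single_right]
    rw [this]
    simp only [Fin.tail, mul_assoc]

theorem inner_toLp_toL2 {f : EuclideanSpace ℝ (Fin n) → ℝ}
    (hf : MemLp f 2 (volume.restrict (Ω : Set (EuclideanSpace ℝ (Fin n))))) (φ : 𝓓(Ω, ℝ)) :
    inner ℝ (hf.toLp f) (toL2 Ω φ) = ∫ x, f x * φ x := by
  rw [L2.inner_def]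
  have h1 : (fun x => inner ℝ (hf.toLp f x) (toL2 Ω φ x)) =ᵐ[volume.restrict Ω]
      fun x => f x * φ x := by
    filter_upwards [hf.coeFn_toLp, (φ.continuous.memLp_of_hasCompactSupport
      φ.hasCompactSupport : MemLp φ 2 (volume.restrict Ω)).coeFn_toLp] with x hx hy
    have hy' : (toL2 Ω φ) x = φ x := hy
    rw [hx, hy']
    simp [mul_comm]
  rw [integral_congr_ae h1, setIntegral_eq_integral_of_forall_compl_eq_zero]
  intro x hx
  rw [image_eq_zero_of_notMem_tsupport (fun h => hx (φ.tsupport_subset h)), mul_zero]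

/-! ### Plane waves on Ω: Bessel and Plancherel -/

section Waves

variable [IsFiniteMeasure (volume.restrict (Ω : Set (EuclideanSpace ℝ (Fin n))))]

variable (Ω) in
/-- The function `x ↦ cos (2π x·ξ)` in `L²(Ω)`. -/
def cosWave (ξ : EuclideanSpace ℝ (Fin n)) : L2 Ω :=
  (MemLp.of_bound (f := fun x : EuclideanSpace ℝ (Fin n) => cos (2 * π * inner ℝ x ξ))
    (by fun_prop) 1 (.of_forall fun x => by simpa using abs_cos_le_one _)).toLp _

variable (Ω) in
/-- The function `x ↦ sin (2π x·ξ)` in `L²(Ω)`. -/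
def sinWave (ξ : EuclideanSpace ℝ (Fin n)) : L2 Ω :=
  (MemLp.of_bound (f := fun x : EuclideanSpace ℝ (Fin n) => sin (2 * π * inner ℝ x ξ))
    (by fun_prop) 1 (.of_forall fun x => by simpa using abs_sin_le_one _)).toLp _

/-- The Fourier transform `∫_Ω u(x) exp (-2πi x·ξ) dx` of `u ∈ L²(Ω)`. -/
def hat (u : L2 Ω) (ξ : EuclideanSpace ℝ (Fin n)) : ℂ :=
  ⟨inner ℝ (cosWave Ω ξ) u, -inner ℝ (sinWave Ω ξ) u⟩

theorem hat_toL2 (φ : 𝓓(Ω, ℝ)) (ξ : EuclideanSpace ℝ (Fin n)) :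
    hat (toL2 Ω φ) ξ = 𝓕 (toSchwartz φ) ξ := by
  rw [SchwartzMap.fourier_coe, Real.fourier_eq']
  have hint : Integrable (fun x =>
      Complex.exp (↑(-2 * π * inner ℝ x ξ) * Complex.I) • toSchwartz φ x) := by
    refine (toSchwartz φ).integrable.mono (by fun_prop) (.of_forall fun x => ?_)
    rw [norm_smul, Complex.norm_exp_ofReal_mul_I, one_mul]
  have key (x) : Complex.exp (↑(-2 * π * inner ℝ x ξ) * Complex.I) • toSchwartz φ x =
      (cos (2 * π * inner ℝ x ξ) * φ x : ℝ) -
        (sin (2 * π * inner ℝ x ξ) * φ x : ℝ) * Complex.I := by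
    rw [Complex.exp_mul_I, ← Complex.ofReal_cos, ← Complex.ofReal_sin]
    simp only [neg_mul, cos_neg, sin_neg, toSchwartz_apply, smul_eq_mul]
    push_cast
    ring
  apply Complex.ext
  · change inner ℝ (cosWave Ω ξ) _ = Complex.reCLM _
    rw [← Complex.reCLM.integral_comp_comm hint, cosWave, inner_toLp_toL2]
    congr with x
    rw [key]
    simp [-Complex.ofReal_mul, -Complex.ofReal_cos, -Complex.ofReal_sin]
  · change -inner ℝ (sinWave Ω ξ) _ = Complex.imCLM _
    rw [← Complex.imCLM.integral_comp_comm hint, sinWave, inner_toLp_toL2, ← integral_neg]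
    congr with x
    rw [key]
    simp [-Complex.ofReal_mul, -Complex.ofReal_cos, -Complex.ofReal_sin]

/-- For fixed ξ the transform is a pairing with two fixed vectors of L²(Ω), so convergence holds at
every ξ, not merely almost everywhere. -/
theorem tendsto_hat {u : L2 Ω} {v : ℕ → L2 Ω}
    (h : Filter.Tendsto v Filter.atTop (nhds u)) (ξ : EuclideanSpace ℝ (Fin n)) :
    Filter.Tendsto (fun m => hat (v m) ξ) Filter.atTop (nhds (hat u ξ)) := by
  have h1 := (Complex.continuous_ofReal.tendsto _).comp
    ((tendsto_const_nhds (x := cosWave Ω ξ)).inner (𝕜 := ℝ) h)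
  have h2 := (Complex.continuous_ofReal.tendsto _).comp
    ((tendsto_const_nhds (x := sinWave Ω ξ)).inner (𝕜 := ℝ) h)
  have key (w : L2 Ω) : hat w ξ = ((inner ℝ (cosWave Ω ξ) w : ℝ) : ℂ) -
      ((inner ℝ (sinWave Ω ξ) w : ℝ) : ℂ) * Complex.I := by
    apply Complex.ext <;> simp [hat]
  simp only [key]
  exact h1.sub (h2.mul_const _)

theorem norm_hat_sq (u : L2 Ω) (ξ : EuclideanSpace ℝ (Fin n)) :
    ‖hat u ξ‖ ^ 2 = inner ℝ u (cosWave Ω ξ) ^ 2 + inner ℝ u (sinWave Ω ξ) ^ 2 := by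
  rw [← Complex.normSq_eq_norm_sq, Complex.normSq_apply, hat, real_inner_comm (cosWave Ω ξ),
    real_inner_comm (sinWave Ω ξ)]
  ring

theorem norm_waves_sq (ξ : EuclideanSpace ℝ (Fin n)) :
    ‖cosWave Ω ξ‖ ^ 2 + ‖sinWave Ω ξ‖ ^ 2 = volume.real (Ω : Set (EuclideanSpace ℝ (Fin n))) := by
  rw [← real_inner_self_eq_norm_sq, ← real_inner_self_eq_norm_sq, L2.inner_def, L2.inner_def,
    ← integral_add (L2.integrable_inner _ _) (L2.integrable_inner _ _)]
  have : (fun x => inner ℝ (cosWave Ω ξ x) (cosWave Ω ξ x) +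
      inner ℝ (sinWave Ω ξ x) (sinWave Ω ξ x)) =ᵐ[volume.restrict Ω] fun _ => (1 : ℝ) := by
    filter_upwards [MemLp.coeFn_toLp (_ : MemLp (fun x : EuclideanSpace ℝ (Fin n) =>
        cos (2 * π * inner ℝ x ξ)) 2 (volume.restrict Ω)),
      MemLp.coeFn_toLp (_ : MemLp (fun x : EuclideanSpace ℝ (Fin n) =>
        sin (2 * π * inner ℝ x ξ)) 2 (volume.restrict Ω))] with x hx hy
    rw [cosWave, sinWave, hx, hy]
    simp only [real_inner_self_eq_norm_sq, norm_eq_abs, sq_abs]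
    exact cos_sq_add_sin_sq _
  rw [integral_congr_ae this]
  simp [Measure.real]

/-- Bessel's inequality for the plane waves on `Ω`. -/
theorem sum_norm_hat_sq_le {ι : Type*} [Fintype ι] {u : ι → L2 Ω} (hu : Orthonormal ℝ u)
    (ξ : EuclideanSpace ℝ (Fin n)) :
    ∑ j, ‖hat (u j) ξ‖ ^ 2 ≤ volume.real (Ω : Set (EuclideanSpace ℝ (Fin n))) := by
  have h1 := hu.sum_inner_products_le (cosWave Ω ξ) (s := Finset.univ)
  have h2 := hu.sum_inner_products_le (sinWave Ω ξ) (s := Finset.univ)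
  simp only [norm_eq_abs, sq_abs] at h1 h2
  simp only [norm_hat_sq, Finset.sum_add_distrib]
  rw [← norm_waves_sq ξ]
  exact add_le_add h1 h2

/-- Plancherel's theorem for `L²`-limits of test functions. -/
theorem integrable_norm_hat_sq_and_integral_eq {u : L2 Ω} {φ : ℕ → 𝓓(Ω, ℝ)}
    (h : Filter.Tendsto (fun m => toL2 Ω (φ m)) Filter.atTop (nhds u)) :
    Integrable (fun ξ => ‖hat u ξ‖ ^ 2) ∧ ∫ ξ, ‖hat u ξ‖ ^ 2 = ‖u‖ ^ 2 := by
  let F (m : ℕ) := (𝓕 (toSchwartz (φ m))).toLp 2 volume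
  -- The Fourier transform is isometric on Schwartz functions, so the transforms form a Cauchy
  -- sequence in L².
  have hdist (a b : ℕ) : dist (F a) (F b) = dist (toL2 Ω (φ a)) (toL2 Ω (φ b)) := by
    rw [dist_eq_norm, dist_eq_norm, ← map_sub, ← norm_toSchwartz_toLp,
      ← SchwartzMap.norm_fourier_toL2_eq, toSchwartz_sub]
    congr 1
    have := map_sub (SchwartzMap.toLpCLM ℂ ℂ 2 (volume : Measure (EuclideanSpace ℝ (Fin n))))
      (𝓕 (toSchwartz (φ a))) (𝓕 (toSchwartz (φ b)))
    simp only [SchwartzMap.toLpCLM_apply] at this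
    rw [← this]
    congr 1
    exact map_sub (FourierTransform.fourierCLM ℂ 𝓢(EuclideanSpace ℝ (Fin n), ℂ)) _ _ |>.symm
  have hF : CauchySeq F := by
    rw [Metric.cauchySeq_iff]
    simpa only [hdist] using Metric.cauchySeq_iff.1 h.cauchySeq
  obtain ⟨G, hG⟩ := cauchySeq_tendsto_of_complete hF
  have hnorm : ‖G‖ = ‖u‖ := by
    refine tendsto_nhds_unique hG.norm (h.norm.congr fun m => ?_)
    rw [← norm_toSchwartz_toLp, ← SchwartzMap.norm_fourier_toL2_eq]
  -- A subsequence converges almost everywhere to `G` and everywhere to `hat u`, which identifies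
  -- the two.
  obtain ⟨σ, hσ, hae⟩ := (tendstoInMeasure_of_tendsto_Lp hG).exists_seq_tendsto_ae
  have hcoe : ∀ᵐ ξ, ∀ m, F m ξ = hat (toL2 Ω (φ m)) ξ := by
    rw [ae_all_iff]
    intro m
    filter_upwards [SchwartzMap.coeFn_toLp (𝓕 (toSchwartz (φ m))) 2 volume] with ξ hξ
    rw [hat_toL2]
    exact hξ
  have hGu : ∀ᵐ ξ, G ξ = hat u ξ := by
    filter_upwards [hae, hcoe] with ξ h1 h2
    refine tendsto_nhds_unique h1 ?_
    simp only [h2]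
    exact (tendsto_hat h ξ).comp hσ.tendsto_atTop
  have hsq : (fun ξ => ‖hat u ξ‖ ^ 2) =ᵐ[volume] fun ξ => ‖G ξ‖ ^ 2 := by
    filter_upwards [hGu] with ξ hξ
    rw [hξ]
  refine ⟨((Lp.memLp G).integrable_norm_pow (by simp)).congr hsq.symm, ?_⟩
  rw [integral_congr_ae hsq, ← hnorm, ← inner_self_eq_norm_sq (𝕜 := ℂ), L2.inner_def,
    ← integral_re (L2.integrable_inner _ _)]
  simp only [inner_self_eq_norm_sq (𝕜 := ℂ)]

theorem hat_eq_of_tendsto_partialDeriv {u g : L2 Ω} {φ : ℕ → 𝓓(Ω, ℝ)} {i : ℕ} {s : Fin i → Fin n}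
    (h : Filter.Tendsto (fun m => toL2 Ω (φ m)) Filter.atTop (nhds u))
    (hs : Filter.Tendsto (fun m => toL2 Ω (partialDeriv s (φ m))) Filter.atTop (nhds g))
    (ξ : EuclideanSpace ℝ (Fin n)) :
    hat g ξ = (∏ j, (2 * π * Complex.I) * (ξ (s j) : ℂ)) * hat u ξ := by
  refine tendsto_nhds_unique (tendsto_hat hs ξ) (((tendsto_hat h ξ).const_mul _).congr fun m => ?_)
  rw [hat_toL2, hat_toL2, fourier_toSchwartz_partialDeriv]

end Waves

/-! ### The weak equation as a symmetric bilinear form -/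

theorem partialDeriv_cons {i : ℕ} (a : Fin n) (s : Fin i → Fin n) (φ : 𝓓(Ω, ℝ)) :
    partialDeriv (Fin.cons a s) φ =
      ∂_{EuclideanSpace.single a (1 : ℝ)} (partialDeriv s φ) := rfl

theorem partialDeriv_lineDerivOp {i : ℕ} (v : EuclideanSpace ℝ (Fin n)) (s : Fin i → Fin n)
    (φ : 𝓓(Ω, ℝ)) : partialDeriv s (∂_{v} φ) = ∂_{v} (partialDeriv s φ) := by
  induction s using Fin.consInduction with
  | elim0 => rfl
  | cons a s ih => rw [partialDeriv_cons, partialDeriv_cons, ih, lineDerivOp_comm]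

/-- Summing over words `s` rather than multi-indices avoids multinomial coefficients; reordering
uses that partial derivatives commute. -/
theorem polyLaplacian_eq_sum (l : ℕ) (φ : 𝓓(Ω, ℝ)) :
    polyLaplacian Ω l φ =
      (-1 : ℝ) ^ l • ∑ s : Fin l → Fin n, partialDeriv s (partialDeriv s φ) := by
  induction l with
  | zero => simp [polyLaplacian, partialDeriv]
  | succ l ih =>
    have h : polyLaplacian Ω (l + 1) φ =
        -LineDeriv.laplacianCLM ℝ (EuclideanSpace ℝ (Fin n)) 𝓓(Ω, ℝ) (polyLaplacian Ω l φ) :=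
      Function.iterate_succ_apply' _ _ _
    rw [h, ih, map_smul, map_sum, pow_succ, mul_neg_one, neg_smul]
    congr 2
    rw [← (Fin.consEquiv fun _ : Fin (l + 1) => Fin n).sum_comp, Fintype.sum_prod_type,
      Finset.sum_comm]
    refine Finset.sum_congr rfl fun s _ => ?_
    rw [LineDeriv.laplacianCLM_eq_sum (EuclideanSpace.basisFun (Fin n) ℝ)]
    refine Finset.sum_congr rfl fun a _ => ?_
    simp only [Fin.consEquiv, Equiv.coe_fn_mk, EuclideanSpace.basisFun_apply]
    rw [partialDeriv_cons, partialDeriv_cons, partialDeriv_lineDerivOp]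

/-- Half of the derivatives move onto `u`; the sign of the weak derivative cancels the sign of the
operator. -/
theorem inner_toL2_polyLaplacian {l : ℕ} {u : L2 Ω} {g : (Fin l → Fin n) → L2 Ω}
    (hg : ∀ s, HasWeakDeriv s u (g s)) (φ : 𝓓(Ω, ℝ)) :
    inner ℝ u (toL2 Ω (polyLaplacian Ω l φ)) =
      ∑ s, inner ℝ (g s) (toL2 Ω (partialDeriv s φ)) := by
  rw [polyLaplacian_eq_sum, map_smul, map_sum, real_inner_smul_right, inner_sum, Finset.mul_sum]
  refine Finset.sum_congr rfl fun s _ => ?_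
  rw [hg s, ← mul_assoc, ← mul_pow]
  simp

/-- Test functions separate the points of `L²(Ω)`. -/
theorem eq_zero_of_forall_inner_toL2_eq_zero {w : L2 Ω}
    (h : ∀ φ : 𝓓(Ω, ℝ), inner ℝ w (toL2 Ω φ) = 0) : w = 0 := by
  have hw := Lp.memLp w
  have hloc : LocallyIntegrableOn w (Ω : Set (EuclideanSpace ℝ (Fin n))) volume :=
    locallyIntegrableOn_of_locallyIntegrable_restrict
      (hw.locallyIntegrable (by norm_num))
  have h0 := Ω.isOpen.ae_eq_zero_of_integral_contDiff_smul_eq_zero hloc fun g hg hgc hgs => by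
    let φ : 𝓓(Ω, ℝ) := ⟨g, hg, hgc, hgs⟩
    have h1 := h φ
    rw [← Lp.toLp_coeFn w hw, inner_toLp_toL2 hw φ] at h1
    simpa [mul_comm, φ] using h1
  rw [Lp.eq_zero_iff_ae_eq_zero]
  exact (ae_restrict_iff' Ω.isOpen.measurableSet).2 h0

theorem MemSobolevZero.exists_tendsto {l : ℕ} {u : L2 Ω} (hu : MemSobolevZero Ω l u) :
    ∃ (g : (Fin l → Fin n) → L2 Ω) (φ : ℕ → 𝓓(Ω, ℝ)), (∀ s, HasWeakDeriv s u (g s)) ∧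
      Filter.Tendsto (fun m => toL2 Ω (φ m)) Filter.atTop (nhds u) ∧
      ∀ s, Filter.Tendsto (fun m => toL2 Ω (partialDeriv s (φ m))) Filter.atTop (nhds (g s)) := by
  obtain ⟨g, hg, φ, hφ⟩ := hu
  refine ⟨g l, φ, hg l le_rfl, ?_, hφ l le_rfl⟩
  -- The approximating sequence is only known to converge to `g 0`; the weak derivative of order
  -- zero is `u` itself.
  have h0 : u - g 0 Fin.elim0 = 0 := eq_zero_of_forall_inner_toL2_eq_zero fun ψ => by
    have := hg 0 (Nat.zero_le _) Fin.elim0 ψ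
    rw [pow_zero, one_mul] at this
    rw [inner_sub_left, sub_eq_zero]
    exact this
  rw [sub_eq_zero.1 h0]
  exact hφ 0 (Nat.zero_le _) Fin.elim0

/-- The equation tested against the approximants of `v` passes to the limit, so `v` need not be
smooth. -/
theorem mul_inner_eq_sum_inner {l : ℕ} {μ : ℝ} {u v : L2 Ω} {g h : (Fin l → Fin n) → L2 Ω}
    {φ : ℕ → 𝓓(Ω, ℝ)} (hu : u ∈ eigenspace Ω l μ) (hg : ∀ s, HasWeakDeriv s u (g s))
    (hv : Filter.Tendsto (fun m => toL2 Ω (φ m)) Filter.atTop (nhds v))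
    (hh : ∀ s, Filter.Tendsto (fun m => toL2 Ω (partialDeriv s (φ m))) Filter.atTop
      (nhds (h s))) :
    μ * inner ℝ u v = ∑ s, inner ℝ (g s) (h s) := by
  have h1 := (Filter.Tendsto.inner (𝕜 := ℝ) (tendsto_const_nhds (x := u)) hv).const_mul μ
  have h2 := tendsto_finsetSum (Finset.univ : Finset (Fin l → Fin n)) fun s _ =>
    Filter.Tendsto.inner (𝕜 := ℝ) (tendsto_const_nhds (x := g s)) (hh s)
  refine tendsto_nhds_unique h1 (h2.congr fun m => ?_)
  rw [← inner_toL2_polyLaplacian hg, hu.2]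

/-- The bilinear form is symmetric, so μ⟨u,v⟩ = ν⟨u,v⟩. -/
theorem inner_eq_zero_of_mem_eigenspace {l : ℕ} {μ ν : ℝ} (hμν : μ ≠ ν) {u v : L2 Ω}
    (hu : u ∈ eigenspace Ω l μ) (hv : v ∈ eigenspace Ω l ν) : inner ℝ u v = (0 : ℝ) := by
  obtain ⟨g, φ, hg, hφ, hφg⟩ := hu.1.exists_tendsto
  obtain ⟨h, ψ, hh, hψ, hψh⟩ := hv.1.exists_tendsto
  have h1 := mul_inner_eq_sum_inner hu hg hψ hψh
  have h2 : ν * inner ℝ u v = ∑ s, inner ℝ (g s) (h s) := by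
    rw [real_inner_comm, mul_inner_eq_sum_inner hv hh hφ hφg]
    exact Finset.sum_congr rfl fun s _ => real_inner_comm _ _
  have h3 : (μ - ν) * inner ℝ u v = (0 : ℝ) := by rw [sub_mul, h1, h2, sub_self]
  exact (mul_eq_zero.1 h3).resolve_left (sub_ne_zero.2 hμν)

/-! ### Eigenfunctions on the Fourier side and orthonormal families -/

section Spectral

variable [IsFiniteMeasure (volume.restrict (Ω : Set (EuclideanSpace ℝ (Fin n))))]

/-- The Rayleigh quotient of an eigenfunction on the Fourier side. -/
theorem integral_symbol_mul_norm_hat_sq {l : ℕ} {μ : ℝ} {u : L2 Ω} (hu : u ∈ eigenspace Ω l μ) :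
    Integrable (fun ξ => (2 * π * ‖ξ‖) ^ (2 * l) * ‖hat u ξ‖ ^ 2) ∧
      ∫ ξ, (2 * π * ‖ξ‖) ^ (2 * l) * ‖hat u ξ‖ ^ 2 = μ * ‖u‖ ^ 2 := by
  obtain ⟨g, φ, hg, hφ, hφg⟩ := hu.1.exists_tendsto
  have key : (fun ξ => (2 * π * ‖ξ‖) ^ (2 * l) * ‖hat u ξ‖ ^ 2) =
      fun ξ => ∑ s, ‖hat (g s) ξ‖ ^ 2 := by
    funext ξ
    have h1 (s) : ‖hat (g s) ξ‖ ^ 2 = (∏ j, (2 * π * ξ (s j)) ^ 2) * ‖hat u ξ‖ ^ 2 := by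
      rw [hat_eq_of_tendsto_partialDeriv hφ (hφg s), norm_mul, mul_pow, norm_prod,
        ← Finset.prod_pow]
      congr 1
      refine Finset.prod_congr rfl fun j _ => ?_
      simp [mul_pow]
    simp only [h1]
    -- Expanding (∑ᵢ (2πξᵢ)²)^l over words of length `l` produces exactly the squared symbols of the
    -- derivatives.
    rw [← Finset.sum_mul, ← Fintype.sum_pow (fun i => (2 * π * ξ i) ^ 2), pow_mul, mul_pow,
      EuclideanSpace.norm_sq_eq, Finset.mul_sum]
    simp [mul_pow]
  have hP (s) := integrable_norm_hat_sq_and_integral_eq (hφg s)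
  rw [key]
  refine ⟨integrable_finsetSum _ fun s _ => (hP s).1, ?_⟩
  rw [integral_finsetSum _ fun s _ => (hP s).1, ← real_inner_self_eq_norm_sq,
    mul_inner_eq_sum_inner hu hg hφ hφg]
  exact Finset.sum_congr rfl fun s _ => by rw [(hP s).2, real_inner_self_eq_norm_sq]

theorem integral_norm_hat_sq {l : ℕ} {μ : ℝ} {u : L2 Ω} (hu : u ∈ eigenspace Ω l μ) :
    Integrable (fun ξ => ‖hat u ξ‖ ^ 2) ∧ ∫ ξ, ‖hat u ξ‖ ^ 2 = ‖u‖ ^ 2 := by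
  obtain ⟨g, φ, hg, hφ, hφg⟩ := hu.1.exists_tendsto
  exact integrable_norm_hat_sq_and_integral_eq hφ

/-- The symbol vanishes at most at the origin, a null set. If μ ≤ 0, then û = 0 almost everywhere
and Plancherel forces u = 0. -/
theorem pos_of_mem_eigenspace [NeZero n] {l : ℕ} {μ : ℝ} {u : L2 Ω} (hu : u ∈ eigenspace Ω l μ)
    (hu0 : u ≠ 0) : 0 < μ := by
  obtain ⟨hi, he⟩ := integral_symbol_mul_norm_hat_sq hu
  have hnn : 0 ≤ fun ξ : EuclideanSpace ℝ (Fin n) => (2 * π * ‖ξ‖) ^ (2 * l) * ‖hat u ξ‖ ^ 2 :=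
    fun ξ => by positivity
  have hpos : 0 < ‖u‖ ^ 2 := by positivity
  by_contra! hμ
  have h0 : ∫ ξ, (2 * π * ‖ξ‖) ^ (2 * l) * ‖hat u ξ‖ ^ 2 = 0 :=
    le_antisymm (he.trans_le (mul_nonpos_of_nonpos_of_nonneg hμ hpos.le)) (integral_nonneg hnn)
  rw [integral_eq_zero_iff_of_nonneg hnn hi] at h0
  have h1 : (fun ξ => ‖hat u ξ‖ ^ 2) =ᵐ[volume] 0 := by
    filter_upwards [h0, Measure.ae_ne volume (0 : EuclideanSpace ℝ (Fin n))] with ξ hξ hne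
    have : (2 * π * ‖ξ‖) ^ (2 * l) ≠ 0 := by positivity
    exact (mul_eq_zero.1 hξ).resolve_left this
  have h2 := (integral_norm_hat_sq hu).2
  rw [integral_congr_ae h1] at h2
  exact hpos.ne (by simpa using h2)

end Spectral

theorem exists_orthonormal_of_card_le_rank {V ι : Type*} [NormedAddCommGroup V]
    [InnerProductSpace ℝ V] [Fintype ι]
    (h : (Fintype.card ι : Cardinal) ≤ Module.rank ℝ V) : ∃ v : ι → V, Orthonormal ℝ v := by
  obtain ⟨w, hw⟩ := Module.le_rank_iff.1 h
  exact ⟨InnerProductSpace.gramSchmidtNormed ℝ w ∘ Fintype.equivFin ι,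
    (InnerProductSpace.gramSchmidtNormed_orthonormal hw).comp _ (Fintype.equivFin ι).injective⟩

/-- No spectral theorem is needed: the multiplicity leaves room in each eigenspace for Gram–Schmidt,
and distinct eigenspaces are orthogonal. -/
theorem IsEigenvalueList.exists_orthonormal {l : ℕ} {ev : ℕ → ℝ} (hev : IsEigenvalueList Ω l ev)
    (k : ℕ) : ∃ u : Fin k → L2 Ω, Orthonormal ℝ u ∧ ∀ j : Fin k, u j ∈ eigenspace Ω l (ev j) := by
  have hex (μ : ℝ) : ∃ v : {j : Fin k // ev j = μ} → eigenspace Ω l μ, Orthonormal ℝ v := by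
    apply exists_orthonormal_of_card_le_rank
    rw [← Cardinal.natCast_le_toENat, ← hev.multiplicity μ, ← ENat.card_eq_coe_fintype_card]
    exact ENat.card_le_card_of_injective
      (f := fun j : {j : Fin k // ev j = μ} => (⟨j.1, j.2⟩ : {j : ℕ | ev j = μ}))
      fun a b hab => by
        simp only [Subtype.mk.injEq] at hab
        exact Subtype.ext (Fin.ext hab)
  choose v hv using hex
  refine ⟨fun j : Fin k => v (ev j) ⟨j, rfl⟩, ⟨fun j => (hv (ev j)).1 _, fun i j hij => ?_⟩,
    fun j => (v (ev j) ⟨j, rfl⟩).2⟩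
  by_cases h : ev i = ev j
  -- The two vectors live in eigenspaces that are equal only propositionally; a free μ allows the
  -- transport.
  · have aux (μ : ℝ) (hμ : ev i = μ) :
        ((v (ev i) ⟨i, rfl⟩ : eigenspace Ω l (ev i)) : L2 Ω) = v μ ⟨i, hμ⟩ := by
      subst hμ; rfl
    dsimp only
    rw [aux _ h]
    exact (hv (ev j)).2 fun hc => hij (congrArg Subtype.val hc)
  · exact inner_eq_zero_of_mem_eigenspace h (v (ev i) ⟨i, rfl⟩).2 (v (ev j) ⟨j, rfl⟩).2

end Polyharmonic

end

noncomputable section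

namespace Polyharmonic

open Real

/-! ### Jensen's inequality and the pointwise bathtub comparison -/

/-- The convex function `t ↦ t ^ (-p)` lies above its tangent at `a`. -/
theorem rpow_neg_tangent_le {a t p : ℝ} (ha : 0 < a) (ht : 0 < t) (hp : 0 < p) :
    a ^ (-p) - p * a ^ (-p) * (t / a - 1) ≤ t ^ (-p) := by
  have hs : 0 < t / a := div_pos ht ha
  have h1 : 1 - p * (t / a - 1) ≤ (t / a) ^ (-p) := by
    rw [rpow_def_of_pos hs]
    have h2 := add_one_le_exp (log (t / a) * -p)
    have h3 := mul_le_mul_of_nonneg_left (log_le_sub_one_of_pos hs) hp.le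
    linarith
  have h4 : t ^ (-p) = a ^ (-p) * (t / a) ^ (-p) := by
    rw [← mul_rpow ha.le hs.le, mul_div_cancel₀ _ ha.ne']
  rw [h4]
  have := mul_le_mul_of_nonneg_left h1 (rpow_pos_of_pos ha (-p)).le
  linarith

/-- Jensen's inequality for `t ↦ t ^ (-p)` and the probability density `F`. -/
theorem rpow_neg_le_integral {α : Type*} [MeasurableSpace α] {ν : Measure α} {F t : α → ℝ}
    {a p : ℝ} (ha : 0 < a) (hp : 0 < p) (ht : ∀ᵐ x ∂ν, 0 < t x) (hF0 : ∀ x, 0 ≤ F x)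
    (hF : Integrable F ν) (hF1 : ∫ x, F x ∂ν = 1) (htF : Integrable (fun x => t x * F x) ν)
    (hta : ∫ x, t x * F x ∂ν = a) (hpF : Integrable (fun x => t x ^ (-p) * F x) ν) :
    a ^ (-p) ≤ ∫ x, t x ^ (-p) * F x ∂ν := by
  -- This is the tangent line at the mean `a` times the density; its integral is exactly a^{-p}.
  have hI : Integrable (fun x => (a ^ (-p) + p * a ^ (-p)) * F x -
      p * a ^ (-p) / a * (t x * F x)) ν := (hF.const_mul _).sub (htF.const_mul _)
  calc a ^ (-p) = ∫ x, ((a ^ (-p) + p * a ^ (-p)) * F x - p * a ^ (-p) / a * (t x * F x)) ∂ν := by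
        rw [integral_sub (hF.const_mul _) (htF.const_mul _), integral_const_mul,
          integral_const_mul, hF1, hta, div_mul_cancel₀ _ ha.ne']
        ring
    _ ≤ _ := by
        refine integral_mono_ae hI hpF ?_
        filter_upwards [ht] with x hx
        have := mul_le_mul_of_nonneg_right (rpow_neg_tangent_le ha hx hp) (hF0 x)
        refine le_trans (le_of_eq ?_) this
        ring

/-- The factor ‖x‖^{-a} − R^{-a} is nonnegative inside the ball, where `F` may be replaced by `M`,
and nonpositive outside, where it is dropped. -/
theorem norm_rpow_neg_mul_le {E : Type*} [NormedAddCommGroup E] {F : E → ℝ} {M a R : ℝ}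
    (ha : 0 < a) (hR : 0 < R) (hF0 : ∀ x, 0 ≤ F x) (hFM : ∀ x, F x ≤ M) {x : E} (hx : x ≠ 0) :
    ‖x‖ ^ (-a) * F x ≤ R ^ (-a) * F x +
      (Metric.ball (0 : E) R).indicator (fun x => (‖x‖ ^ (-a) - R ^ (-a)) * M) x := by
  have hx0 : 0 < ‖x‖ := norm_pos_iff.2 hx
  by_cases h : ‖x‖ < R
  · rw [Set.indicator_of_mem (by simpa using h)]
    have h1 : R ^ (-a) ≤ ‖x‖ ^ (-a) := rpow_le_rpow_of_nonpos hx0 h.le (by linarith)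
    have := mul_le_mul_of_nonneg_left (hFM x) (sub_nonneg.2 h1)
    linarith
  · rw [Set.indicator_of_notMem (by simpa using h), add_zero]
    exact mul_le_mul_of_nonneg_right
      (rpow_le_rpow_of_nonpos hR (not_lt.1 h) (by linarith)) (hF0 x)

/-! ### Power weights on balls and the bathtub principle -/

section Bathtub

variable {E : Type*} [NormedAddCommGroup E] [NormedSpace ℝ E] [FiniteDimensional ℝ E]
  [Nontrivial E] [MeasurableSpace E] [BorelSpace E] (ν : Measure E) [ν.IsAddHaarMeasure]

open Module Metric

theorem integrableOn_ball_norm_rpow_neg {a : ℝ} (ha : a < finrank ℝ E) (R : ℝ) :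
    IntegrableOn (fun x : E => ‖x‖ ^ (-a)) (ball 0 R) ν := by
  rw [integrableOn_fun_norm_addHaar ν (f := fun y => y ^ (-a))]
  have hd : 1 ≤ finrank ℝ E := finrank_pos
  rcases le_or_gt R 0 with hR | hR
  · simp [Set.Ioo_eq_empty_of_le hR]
  -- In polar coordinates the exponent is d − 1 − a, which exceeds −1 precisely because a < d.
  have h1 : IntegrableOn (fun y : ℝ => y ^ ((finrank ℝ E : ℝ) - 1 - a)) (Set.Ioo 0 R) := by
    have := intervalIntegral.intervalIntegrable_rpow' (a := 0) (b := R)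
      (r := (finrank ℝ E : ℝ) - 1 - a) (by linarith)
    rw [intervalIntegrable_iff_integrableOn_Ioo_of_le hR.le] at this
    exact this
  refine h1.congr_fun (fun y hy => ?_) measurableSet_Ioo
  dsimp only
  rw [smul_eq_mul, ← rpow_natCast, Nat.cast_sub hd, Nat.cast_one, ← rpow_add hy.1]
  congr 1

theorem integral_ball_norm_rpow_neg {a : ℝ} (ha : a < finrank ℝ E) {R : ℝ} (hR : 0 < R) :
    ∫ x in ball (0 : E) R, ‖x‖ ^ (-a) ∂ν =
      finrank ℝ E / (finrank ℝ E - a) * R ^ (-a) * ν.real (ball (0 : E) R) := by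
  have hd : 1 ≤ finrank ℝ E := finrank_pos
  have h1 : ∫ x in ball (0 : E) R, ‖x‖ ^ (-a) ∂ν =
      ∫ x : E, (Set.Iio R).indicator (fun y => y ^ (-a)) ‖x‖ ∂ν := by
    rw [← integral_indicator measurableSet_ball]
    congr with x
    simp [Set.indicator]
  have h2 : ∫ y in Set.Ioi (0 : ℝ), y ^ (finrank ℝ E - 1) •
      (Set.Iio R).indicator (fun y => y ^ (-a)) y =
      ∫ y in Set.Ioo 0 R, y ^ ((finrank ℝ E : ℝ) - 1 - a) := by
    rw [← integral_indicator measurableSet_Ioi, ← integral_indicator measurableSet_Ioo]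
    congr with y
    by_cases hy : 0 < y <;> by_cases hyR : y < R <;> simp [Set.indicator, hy, hyR]
    rw [← rpow_natCast, Nat.cast_sub hd, Nat.cast_one, ← rpow_add hy]
    congr 1
  rw [h1, integral_fun_norm_addHaar ν, h2, ← integral_Ioc_eq_integral_Ioo,
    ← intervalIntegral.integral_of_le hR.le, integral_rpow (.inl (by linarith)),
    zero_rpow (by linarith), Measure.real, Measure.real, Measure.addHaar_ball ν _ hR.le,
    ENNReal.toReal_mul, ENNReal.toReal_ofReal (by positivity)]
  have h3 : R ^ ((finrank ℝ E : ℝ) - 1 - a + 1) = R ^ finrank ℝ E * R ^ (-a) := by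
    rw [← rpow_natCast, ← rpow_add hR]
    congr 1
    ring
  have h4 : (finrank ℝ E : ℝ) - a ≠ 0 := by linarith
  rw [h3, show (finrank ℝ E : ℝ) - 1 - a + 1 = finrank ℝ E - a by ring]
  simp only [nsmul_eq_mul, smul_eq_mul]
  field_simp
  ring

variable {ν} {F : E → ℝ} {M a R : ℝ}

theorem integrable_indicator_ball_sub (ha : a < finrank ℝ E) :
    Integrable ((ball (0 : E) R).indicator fun x => (‖x‖ ^ (-a) - R ^ (-a)) * M) ν := by
  rw [integrable_indicator_iff measurableSet_ball]
  exact ((integrableOn_ball_norm_rpow_neg ν ha R).sub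
    (integrableOn_const measure_ball_lt_top.ne)).mul_const _

theorem integrable_norm_rpow_neg_mul (ha : 0 < a) (had : a < finrank ℝ E)
    (hF0 : ∀ x, 0 ≤ F x) (hFM : ∀ x, F x ≤ M) (hF : Integrable F ν) :
    Integrable (fun x => ‖x‖ ^ (-a) * F x) ν := by
  refine ((hF.const_mul (1 ^ (-a))).add (integrable_indicator_ball_sub (R := 1) (M := M) had)).mono'
    ((by fun_prop : Measurable fun x : E => ‖x‖ ^ (-a)).aestronglyMeasurable.mul
      hF.aestronglyMeasurable) ?_
  filter_upwards [Measure.ae_ne ν (0 : E)] with x hx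
  rw [norm_of_nonneg (mul_nonneg (by positivity) (hF0 x))]
  exact norm_rpow_neg_mul_le ha one_pos hF0 hFM hx

/-- The bathtub principle for the weight `‖x‖ ^ (-a)`. -/
theorem integral_norm_rpow_neg_mul_le (ha : 0 < a) (had : a < finrank ℝ E) (hR : 0 < R)
    (hF0 : ∀ x, 0 ≤ F x) (hFM : ∀ x, F x ≤ M) (hF : Integrable F ν)
    (hFR : ∫ x, F x ∂ν = M * ν.real (ball (0 : E) R)) :
    ∫ x, ‖x‖ ^ (-a) * F x ∂ν ≤
      finrank ℝ E / (finrank ℝ E - a) * R ^ (-a) * ∫ x, F x ∂ν := by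
  have hi := integrable_indicator_ball_sub (ν := ν) (R := R) (M := M) had
  calc ∫ x, ‖x‖ ^ (-a) * F x ∂ν ≤ ∫ x, (R ^ (-a) * F x +
        (ball (0 : E) R).indicator (fun x => (‖x‖ ^ (-a) - R ^ (-a)) * M) x) ∂ν := by
        refine integral_mono_ae (integrable_norm_rpow_neg_mul ha had hF0 hFM hF)
          ((hF.const_mul _).add hi) ?_
        filter_upwards [Measure.ae_ne ν (0 : E)] with x hx
        exact norm_rpow_neg_mul_le ha hR hF0 hFM hx
    _ = _ := by
        rw [integral_add (hF.const_mul _) hi, integral_const_mul,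
          integral_indicator measurableSet_ball, integral_mul_const,
          integral_sub (integrableOn_ball_norm_rpow_neg ν had R)
            (integrableOn_const measure_ball_lt_top.ne),
          integral_ball_norm_rpow_neg ν had hR, hFR, setIntegral_const, smul_eq_mul]
        ring

end Bathtub

/-! ### Combining the estimates and computing the constant -/

/-- The sum of the powers `a j ^ (-p)` of the moments of densities whose sum is at most `M`. -/
theorem sum_rpow_neg_le {n l k : ℕ} [NeZero n] (hl : 1 ≤ l) {p M R : ℝ} (hp : 0 < p)
    (hpn : 2 * l * p < n) (hR : 0 < R) {F : Fin k → EuclideanSpace ℝ (Fin n) → ℝ} {a : Fin k → ℝ}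
    (ha : ∀ j, 0 < a j) (hF0 : ∀ j ξ, 0 ≤ F j ξ) (hF : ∀ j, Integrable (F j))
    (hF1 : ∀ j, ∫ ξ, F j ξ = 1)
    (hm : ∀ j, Integrable fun ξ => (2 * π * ‖ξ‖) ^ (2 * l) * F j ξ)
    (hma : ∀ j, ∫ ξ, (2 * π * ‖ξ‖) ^ (2 * l) * F j ξ = a j) (hM : ∀ ξ, ∑ j, F j ξ ≤ M)
    (hRk : M * volume.real (Metric.ball (0 : EuclideanSpace ℝ (Fin n)) R) = k) :
    ∑ j, a j ^ (-p) ≤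
      (2 * π) ^ (-(2 * l * p)) * ((n : ℝ) / (n - 2 * l * p) * R ^ (-(2 * l * p)) * k) := by
  have hc : 0 < 2 * l * p := by positivity
  have hfr : (Module.finrank ℝ (EuclideanSpace ℝ (Fin n)) : ℝ) = n := by simp
  have hcn : 2 * l * p < Module.finrank ℝ (EuclideanSpace ℝ (Fin n)) := by rwa [hfr]
  have hle (j ξ) : F j ξ ≤ M :=
    (Finset.single_le_sum (f := fun j => F j ξ) (fun i _ => hF0 i ξ) (Finset.mem_univ j)).trans
      (hM ξ)
  have hpow (ξ : EuclideanSpace ℝ (Fin n)) (y : ℝ) : ((2 * π * ‖ξ‖) ^ (2 * l)) ^ (-p) * y =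
      (2 * π) ^ (-(2 * l * p)) * (‖ξ‖ ^ (-(2 * l * p)) * y) := by
    rw [← rpow_natCast, ← rpow_mul (by positivity), mul_rpow (by positivity) (by positivity)]
    push_cast
    rw [mul_neg, mul_assoc]
  have hint (j) := integrable_norm_rpow_neg_mul hc hcn (hF0 j) (hle j) (hF j)
  have hsumF : ∫ ξ, ∑ j, F j ξ = k := by
    rw [integral_finsetSum _ fun j _ => hF j]
    simp [hF1]
  calc ∑ j, a j ^ (-p)
      ≤ ∑ j, ∫ ξ, ((2 * π * ‖ξ‖) ^ (2 * l)) ^ (-p) * F j ξ := by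
        refine Finset.sum_le_sum fun j _ => ?_
        refine rpow_neg_le_integral (ha j) hp ?_ (hF0 j) (hF j) (hF1 j) (hm j) (hma j) ?_
        · filter_upwards [Measure.ae_ne volume (0 : EuclideanSpace ℝ (Fin n))] with ξ hξ
          positivity
        · simpa only [hpow] using (hint j).const_mul _
    _ = (2 * π) ^ (-(2 * l * p)) * ∫ ξ, ‖ξ‖ ^ (-(2 * l * p)) * ∑ j, F j ξ := by
        simp only [hpow, integral_const_mul]
        rw [← Finset.mul_sum, ← integral_finsetSum _ fun j _ => hint j]
        simp only [Finset.mul_sum]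
    _ ≤ _ := by
        refine mul_le_mul_of_nonneg_left ?_ (by positivity)
        have := integral_norm_rpow_neg_mul_le hc hcn hR
          (fun ξ => Finset.sum_nonneg fun j _ => hF0 j ξ) hM (integrable_finsetSum _ fun j _ => hF j)
          (hsumF.trans hRk.symm)
        rwa [hsumF, hfr] at this

theorem volume_real_ball {n : ℕ} [NeZero n] {R : ℝ} (hR : 0 ≤ R) :
    volume.real (Metric.ball (0 : EuclideanSpace ℝ (Fin n)) R) =
      R ^ n * (√π ^ n / Gamma (1 + (n : ℝ) / 2)) := by
  have hG : 0 < Gamma ((n : ℝ) / 2 + 1) := Gamma_pos_of_pos (by positivity)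
  rw [Measure.real, EuclideanSpace.volume_ball, Fintype.card_fin, ENNReal.toReal_mul,
    ENNReal.toReal_pow, ENNReal.toReal_ofReal hR, ENNReal.toReal_ofReal (by positivity),
    add_comm (1 : ℝ)]

theorem constant_eq {n l p M G k : ℝ} (hn : 0 < n) (hM : 0 < M) (hG : 0 < G) (hk : 0 < k) :
    (2 * π) ^ (-(2 * l * p)) *
        (n / (n - 2 * l * p) * ((k / (M * (√π ^ n / G))) ^ n⁻¹) ^ (-(2 * l * p)) * k) =
      (4 * π) ^ (-(l * p)) * (n / (n - 2 * l * p)) * (M / G) ^ (2 * l * p / n) *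
        k ^ (1 - 2 * l * p / n) := by
  have h1 : ((k / (M * (√π ^ n / G))) ^ n⁻¹) ^ (-(2 * l * p)) =
      (M / G) ^ (2 * l * p / n) * π ^ (l * p) * k ^ (-(2 * l * p / n)) := by
    have hs : k / (M * (√π ^ n / G)) = (M / G * √π ^ n)⁻¹ * k := by field_simp
    rw [hs, ← rpow_mul (by positivity), mul_rpow (by positivity) hk.le,
      inv_rpow (by positivity), ← rpow_neg (by positivity), mul_rpow (by positivity) (by positivity),
      ← rpow_mul (by positivity), sqrt_eq_rpow, ← rpow_mul pi_pos.le]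
    congr 2
    · congr 1
      field_simp
    · congr 1
      field_simp
    · field_simp
  have h2 : (2 * π) ^ (-(2 * l * p)) * π ^ (l * p) = (4 * π) ^ (-(l * p)) := by
    have h3 : (2 * π) ^ (-(2 * l * p)) = (4 * π) ^ (-(l * p)) * π ^ (-(l * p)) := by
      rw [← mul_rpow (by positivity) (by positivity), show 4 * π * π = (2 * π) ^ (2 : ℝ) by
        rw [rpow_two]; ring, ← rpow_mul (by positivity)]
      congr 1
      ring
    rw [h3, mul_assoc, ← rpow_add pi_pos]
    simp
  rw [h1, ← h2, sub_eq_add_neg 1, rpow_add hk, rpow_one]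
  ring

end Polyharmonic

end

theorem theorem1p4 (n l : ℕ) (hn : 2 ≤ n) (hl : 1 ≤ l)
    (Ω : TopologicalSpace.Opens (EuclideanSpace ℝ (Fin n)))
    (hΩc : IsConnected (Ω : Set (EuclideanSpace ℝ (Fin n))))
    (hΩb : Bornology.IsBounded (Ω : Set (EuclideanSpace ℝ (Fin n))))
    (ev : ℕ → ℝ) (hev : Polyharmonic.IsEigenvalueList Ω l ev)
    (p : ℝ) (hp : 0 < p) (hpn : p < (n : ℝ) / (2 * l)) (k : ℕ) :
    (∀ j, 0 < ev j) ∧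
    ∑ j ∈ Finset.range k, ev j ^ (-p) ≤
      (4 * Real.pi) ^ (-(l * p)) * ((n : ℝ) / (n - 2 * l * p)) *
        (MeasureTheory.volume.real (Ω : Set (EuclideanSpace ℝ (Fin n))) /
          Real.Gamma (1 + (n : ℝ) / 2)) ^ (2 * l * p / n) *
        (k : ℝ) ^ (1 - 2 * l * p / n) := by
  have : NeZero n := ⟨by omega⟩
  have hn0 : (0 : ℝ) < n := by positivity
  have hfin : volume (Ω : Set (EuclideanSpace ℝ (Fin n))) < ⊤ := hΩb.measure_lt_top
  have : IsFiniteMeasure (volume.restrict (Ω : Set (EuclideanSpace ℝ (Fin n)))) :=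
    ⟨by simpa using hfin⟩
  have hM : 0 < volume.real (Ω : Set (EuclideanSpace ℝ (Fin n))) :=
    ENNReal.toReal_pos (Ω.isOpen.measure_pos _ hΩc.nonempty).ne' hfin.ne
  have hpos (j : ℕ) : 0 < ev j := by
    obtain ⟨u, hu, hmem⟩ := hev.exists_orthonormal (j + 1)
    exact Polyharmonic.pos_of_mem_eigenspace (hmem (Fin.last j)) (hu.ne_zero _)
  refine ⟨hpos, ?_⟩
  have hl0 : (0 : ℝ) < l := by exact_mod_cast hl
  have hlt : 2 * l * p < n := by
    rw [lt_div_iff₀ (by positivity)] at hpn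
    linarith
  -- For `k = 0` the ball would degenerate; the right side is zero since its exponent is positive.
  rcases Nat.eq_zero_or_pos k with rfl | hk
  · have h1 : 2 * l * p / n < 1 := (div_lt_one hn0).2 hlt
    rw [Nat.cast_zero, Real.zero_rpow (by linarith)]
    simp
  have hk0 : (0 : ℝ) < k := by exact_mod_cast hk
  have hG : 0 < Real.Gamma (1 + (n : ℝ) / 2) := Real.Gamma_pos_of_pos (by positivity)
  obtain ⟨u, hu, hmem⟩ := hev.exists_orthonormal k
  -- The radius is the `n`-th root of this quotient, the solution of |Ω||B_R| = k.
  have hX : 0 < k / (volume.real (Ω : Set (EuclideanSpace ℝ (Fin n))) *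
      (√Real.pi ^ (n : ℝ) / Real.Gamma (1 + (n : ℝ) / 2))) := by positivity
  have hsum := Polyharmonic.sum_rpow_neg_le (F := fun j ξ => ‖Polyharmonic.hat (u j) ξ‖ ^ 2)
    (a := fun j => ev j) hl hp hlt (Real.rpow_pos_of_pos hX (n : ℝ)⁻¹) (fun j => hpos j)
    (fun j ξ => by positivity) (fun j => (Polyharmonic.integral_norm_hat_sq (hmem j)).1)
    (fun j => by rw [(Polyharmonic.integral_norm_hat_sq (hmem j)).2, hu.1 j, one_pow])
    (fun j => (Polyharmonic.integral_symbol_mul_norm_hat_sq (hmem j)).1)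
    (fun j => by
      rw [(Polyharmonic.integral_symbol_mul_norm_hat_sq (hmem j)).2, hu.1 j, one_pow, mul_one])
    (fun ξ => Polyharmonic.sum_norm_hat_sq_le hu ξ)
    (by
      rw [Polyharmonic.volume_real_ball (by positivity), ← Real.rpow_natCast (_ ^ _) n,
        ← Real.rpow_mul hX.le, inv_mul_cancel₀ hn0.ne', Real.rpow_one, Real.rpow_natCast]
      field_simp)
  rw [Polyharmonic.constant_eq hn0 hM hG hk0] at hsum
  rwa [Finset.sum_range]
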